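/- For every constant $p\in(0,1]$ there are a constant $c>0$ and an integer $N$, depending only on $p$, such that the following holds for every $n\ge N$ and any two distinct vertices $s,t\in[n]$. Consider a randomized cut-query algorithm, i.e. a probability distribution over deterministic adaptive algorithms that access an unknown unweighted (simple, undirected) graph $G$ on the vertex set $[n]$ only by querying sets $S\subseteq[n]$, the answer to $S$ being the number of edges of $G$ with exactly one endpoint in $S$. Suppose that on every such graph $G$, with probability at least $p$, the algorithm recovers all edges of a maximum $s,t$-flow, i.e. it outputs a set of edges of $G$ that contains every edge carrying flow in some maximum $s,t$-flow of $G$ (where every edge has capacity $1$ in either direction). Then there is a graph $G$ on $[n]$ on which the algorithm makes at least $c\, n^{3/2}/\log n$ cut queries in expectation (hence also in the worst case). In other words, every randomized cut-query algorithm that recovers all edges of a maximum $s,t$-flow in an unweighted graph on $n$ vertices and succeeds with constant probability requires $\Omega(n^{3/2}/\log n)$ cut queries. -/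

import Mathlib

open scoped ENNReal

namespace CutQuery

/-- The cut function of an unweighted (simple, undirected) graph `G`: the number of edges with one
endpoint in `S` and the other endpoint outside `S`. -/
noncomputable def cutValue {V : Type*} [Fintype V] (G : SimpleGraph V) (S : Finset V) : ℕ := by
  classical exact (G.interedges S Sᶜ).card

/-- A deterministic adaptive cut-query algorithm on the vertex set `V` with outputs in `α`, as a
decision tree: it either stops with an output, or it queries a vertex set `S` and continues in a way
that depends on the answer. It accesses the input graph only through the answers. -/
inductive DecisionTree (V : Type*) (α : Type*) where
  | output (a : α) : DecisionTree V α
  | query (S : Finset V) (next : ℕ → DecisionTree V α) : DecisionTree V α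

namespace DecisionTree

variable {V : Type*} [Fintype V] {α : Type*}

/-- The output on input graph `G`; each query `S` is answered by the cut value of `S` in `G`. -/
noncomputable def run (G : SimpleGraph V) : DecisionTree V α → α
  | output a => a
  | query S next => (next (cutValue G S)).run G

/-- The number of cut queries made on input graph `G`. -/
noncomputable def queryCount (G : SimpleGraph V) : DecisionTree V α → ℕ
  | output _ => 0
  | query S next => (next (cutValue G S)).queryCount G + 1

end DecisionTree

/-- A randomized cut-query algorithm: a random deterministic algorithm, i.e. a family of decision
trees indexed by the random coins `ω` of an arbitrary probability space. On every input graph the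
output and the number of queries are random variables. -/
structure RandomizedAlgorithm.{u, v, w} (V : Type v) [Fintype V] (α : Type w) where
  /-- the space of random coins -/
  Ω : Type u
  [measurableSpace : MeasurableSpace Ω]
  /-- the distribution of the random coins -/
  μ : MeasureTheory.Measure Ω
  [isProbabilityMeasure : MeasureTheory.IsProbabilityMeasure μ]
  /-- the deterministic algorithm executed when the coins are `ω` -/
  tree : Ω → DecisionTree V α
  measurableSet_run : ∀ (G : SimpleGraph V) (a : α), MeasurableSet {ω | (tree ω).run G = a}
  measurableSet_queryCount : ∀ (G : SimpleGraph V) (k : ℕ),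
    MeasurableSet {ω | (tree ω).queryCount G = k}

namespace RandomizedAlgorithm

variable {V : Type*} [Fintype V] {α : Type*}

/-- The probability that the output on `G` satisfies `good`. -/
noncomputable def successProb (A : RandomizedAlgorithm V α) (G : SimpleGraph V)
    (good : α → Prop) : ℝ≥0∞ :=
  letI := A.measurableSpace
  A.μ {ω | good ((A.tree ω).run G)}

/-- The expected number of cut queries on `G`. -/
noncomputable def expectedQueries (A : RandomizedAlgorithm V α) (G : SimpleGraph V) : ℝ≥0∞ :=
  letI := A.measurableSpace
  ∫⁻ ω, ((A.tree ω).queryCount G : ℝ≥0∞) ∂A.μ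

end RandomizedAlgorithm

section MaxFlow

variable {V : Type*} [Fintype V]

/-- `f` is an `s,t`-flow in `G`, all edges having capacity one: `f u v` is the net amount of flow
sent along the edge `uv` from `u` to `v`. -/
structure IsFlow (G : SimpleGraph V) (s t : V) (f : V → V → ℝ) : Prop where
  antisymm : ∀ u v, f u v = -f v u
  capacity : ∀ u v, G.Adj u v → f u v ≤ 1
  zero_of_not_adj : ∀ u v, ¬ G.Adj u v → f u v = 0
  conservation : ∀ v, v ≠ s → v ≠ t → ∑ w, f v w = 0

/-- The value of a flow with source `s`: the net amount of flow leaving `s`. -/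
def flowValue (s : V) (f : V → V → ℝ) : ℝ := ∑ w, f s w

/-- `f` is a maximum `s,t`-flow in `G`. -/
def IsMaxFlow (G : SimpleGraph V) (s t : V) (f : V → V → ℝ) : Prop :=
  IsFlow G s t f ∧ ∀ g, IsFlow G s t g → flowValue s g ≤ flowValue s f

/-- The set `F` recovers all edges of a maximum `s,t`-flow in `G`: it consists of edges of `G`, and
it contains every edge that carries flow in some maximum `s,t`-flow of `G`. (In particular, this
holds if `F` is exactly the set of edges used by a maximum `s,t`-flow.) -/
def RecoversMaxFlow (G : SimpleGraph V) (s t : V) (F : Finset (Sym2 V)) : Prop :=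
  (∀ e ∈ F, e ∈ G.edgeSet) ∧
    ∃ f, IsMaxFlow G s t f ∧ ∀ u v, f u v ≠ 0 → s(u, v) ∈ F

end MaxFlow

end CutQuery

open Finset

/-! The bound is an information count on graphs that hide `m ^ 3` bits, where `m` is of order `√n`.
Such a graph is the union of `2 * m ^ 2` edge-disjoint paths from `s` to `t` through `m` pairs of
layers of `2 * m` vertices each. Between the two layers of pair `l`, the hidden bit at `(l, i, j)`
decides whether the two paths indexed by `(i, j)` run parallel or cross.

All edges climb one rank, so with the rank as potential the total flow on upward edges is the path
length times the flow value. A maximum flow is worth at least the number of paths, so it must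
saturate every edge (`IsMaxFlow.eq_one_of_rank_lt`). A correct output is therefore the whole edge
set and reveals all bits (`eq_of_recoversMaxFlow_hardGraph`).

A cut query has at most `n ^ 2 + 1` answers, so with fixed coins `Q` queries solve at most `(n ^ 2 +
1) ^ Q` of the `2 ^ (m ^ 3)` instances. Markov's inequality and averaging over instances carry this
over to randomized algorithms (`RandomizedAlgorithm.card_mul_le`). -/

namespace CutQuery

/-! ### Maximum flows in ranked edge-disjoint path systems -/

section PathSystem

variable {V : Type*} {P : Type*}

/-- The graph whose edges are the first `K` steps of the walks `w p`. -/
def walkGraph (w : P → ℕ → V) (K : ℕ) : SimpleGraph V :=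
  SimpleGraph.fromRel fun u v => ∃ p, ∃ k < K, w p k = u ∧ w p (k + 1) = v

/-- `w` is a system of walks of length `K` from `s` to `t`, no two of which share an edge, that
climb along the rank function `r`. -/
structure IsPathSystem (w : P → ℕ → V) (K : ℕ) (s t : V) (r : V → ℕ) : Prop where
  rank : ∀ p, ∀ k ≤ K, r (w p k) = k
  start : ∀ p, w p 0 = s
  finish : ∀ p, w p K = t
  rank_start : r s = 0
  rank_finish : r t = K
  disjoint : ∀ p q, ∀ k < K, w p k = w q k → w p (k + 1) = w q (k + 1) → p = q

theorem walkGraph_adj_of_rank_lt {w : P → ℕ → V} {K : ℕ} {r : V → ℕ}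
    (hr : ∀ p, ∀ k ≤ K, r (w p k) = k) {u v : V} (h : (walkGraph w K).Adj u v) (huv : r u < r v) :
    r u < K ∧ r v = r u + 1 ∧ ∃ p, w p (r u) = u ∧ w p (r u + 1) = v := by
  rw [walkGraph, SimpleGraph.fromRel_adj] at h
  obtain ⟨-, ⟨p, k, hk, rfl, rfl⟩ | ⟨p, k, hk, rfl, rfl⟩⟩ := h
  · rw [hr p k hk.le, hr p (k + 1) hk]
    exact ⟨hk, rfl, p, rfl, rfl⟩
  · rw [hr p k hk.le, hr p (k + 1) hk] at huv
    omega

theorem walkGraph_adj_step {w : P → ℕ → V} {K : ℕ} {r : V → ℕ}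
    (hr : ∀ p, ∀ k ≤ K, r (w p k) = k) (p : P) {k : ℕ} (hk : k < K) :
    (walkGraph w K).Adj (w p k) (w p (k + 1)) := by
  rw [walkGraph, SimpleGraph.fromRel_adj]
  refine ⟨fun h => ?_, Or.inl ⟨p, k, hk, rfl, rfl⟩⟩
  have := congrArg r h
  rw [hr p k hk.le, hr p (k + 1) hk] at this
  omega

theorem walkGraph_adj_rank {w : P → ℕ → V} {K : ℕ} {r : V → ℕ}
    (hr : ∀ p, ∀ k ≤ K, r (w p k) = k) {u v : V} (h : (walkGraph w K).Adj u v) :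
    r u < r v ∨ r v < r u := by
  rw [walkGraph, SimpleGraph.fromRel_adj] at h
  obtain ⟨-, ⟨p, k, hk, rfl, rfl⟩ | ⟨p, k, hk, rfl, rfl⟩⟩ := h <;>
  · rw [hr p k hk.le, hr p (k + 1) hk]
    omega

open scoped Classical in
/-- The number of steps from `u` to `v` made by the walks. -/
noncomputable def stepCount [Fintype P] (w : P → ℕ → V) (K : ℕ) (u v : V) : ℝ :=
  ∑ p, ∑ k ∈ range K, if w p k = u ∧ w p (k + 1) = v then 1 else 0

/-- The flow that sends one unit along each walk. -/
noncomputable def walkFlow [Fintype P] (w : P → ℕ → V) (K : ℕ) (u v : V) : ℝ :=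
  stepCount w K u v - stepCount w K v u

theorem stepCount_nonneg [Fintype P] (w : P → ℕ → V) (K : ℕ) (u v : V) :
    0 ≤ stepCount w K u v :=
  sum_nonneg fun _ _ => sum_nonneg fun _ _ => by split_ifs <;> norm_num

/-- The rank of `u` fixes the time of the step, and edge-disjointness then fixes the walk. -/
theorem stepCount_le_one [Fintype P] {w : P → ℕ → V} {K : ℕ} {s t : V} {r : V → ℕ}
    (hw : IsPathSystem w K s t r) (u v : V) : stepCount w K u v ≤ 1 := by
  classical
  rw [stepCount, ← sum_product']
  simp only [sum_boole]
  norm_cast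
  rw [card_le_one]
  rintro ⟨p, k⟩ hp ⟨q, l⟩ hq
  simp only [mem_filter, mem_product, mem_univ, mem_range, true_and] at hp hq
  have h1 := hw.rank p k hp.1.le
  have h2 := hw.rank q l hq.1.le
  rw [hp.2.1] at h1
  rw [hq.2.1] at h2
  obtain rfl : k = l := h1.symm.trans h2
  rw [hw.disjoint p q k hp.1 (hp.2.1.trans hq.2.1.symm) (hp.2.2.trans hq.2.2.symm)]

theorem stepCount_eq_zero [Fintype P] {w : P → ℕ → V} {K : ℕ} {r : V → ℕ}
    (hr : ∀ p, ∀ k ≤ K, r (w p k) = k) {u v : V} (h : ¬ (walkGraph w K).Adj u v) :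
    stepCount w K u v = 0 := by
  refine sum_eq_zero fun p _ => sum_eq_zero fun k hk => if_neg ?_
  rintro ⟨rfl, rfl⟩
  exact h (walkGraph_adj_step hr p (mem_range.1 hk))

variable [Fintype V]

-- Arrivals and departures telescope along each walk, leaving only its two ends.
open scoped Classical in
theorem sum_walkFlow [Fintype P] (w : P → ℕ → V) (K : ℕ) (u : V) :
    ∑ v, walkFlow w K u v =
      ∑ p, ((if w p 0 = u then (1 : ℝ) else 0) - if w p K = u then 1 else 0) := by
  have h1 : ∑ v, stepCount w K u v = ∑ p, ∑ k ∈ range K, if w p k = u then (1 : ℝ) else 0 := by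
    unfold stepCount
    rw [sum_comm]
    refine sum_congr rfl fun p _ => ?_
    rw [sum_comm]
    refine sum_congr rfl fun k _ => ?_
    by_cases h : w p k = u <;> simp [h]
  have h2 : ∑ v, stepCount w K v u =
      ∑ p, ∑ k ∈ range K, if w p (k + 1) = u then (1 : ℝ) else 0 := by
    unfold stepCount
    rw [sum_comm]
    refine sum_congr rfl fun p _ => ?_
    rw [sum_comm]
    refine sum_congr rfl fun k _ => ?_
    by_cases h : w p (k + 1) = u <;> simp [h]
  simp only [walkFlow, sum_sub_distrib]
  rw [h1, h2, ← sum_sub_distrib, ← sum_sub_distrib]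
  refine sum_congr rfl fun p _ => ?_
  rw [← sum_sub_distrib]
  exact sum_range_sub' (fun k => if w p k = u then (1 : ℝ) else 0) K

theorem isFlow_walkFlow [Fintype P] {w : P → ℕ → V} {K : ℕ} {s t : V} {r : V → ℕ}
    (hw : IsPathSystem w K s t r) : IsFlow (walkGraph w K) s t (walkFlow w K) where
  antisymm u v := by simp [walkFlow]
  capacity u v _ := by
    have h1 := stepCount_le_one hw u v
    have h2 := stepCount_nonneg w K v u
    unfold walkFlow
    linarith
  zero_of_not_adj u v h := by
    have h' : ¬ (walkGraph w K).Adj v u := fun h' => h h'.symm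
    simp [walkFlow, stepCount_eq_zero hw.rank h, stepCount_eq_zero hw.rank h']
  conservation v hs ht := by
    rw [sum_walkFlow]
    refine sum_eq_zero fun p _ => ?_
    rw [hw.start, hw.finish, if_neg hs.symm, if_neg ht.symm, sub_zero]

theorem flowValue_walkFlow [Fintype P] {w : P → ℕ → V} {K : ℕ} {s t : V} {r : V → ℕ}
    (hw : IsPathSystem w K s t r) (hst : s ≠ t) :
    flowValue s (walkFlow w K) = Fintype.card P := by
  rw [flowValue, sum_walkFlow]
  simp [hw.start, hw.finish, hst.symm]

/-- The flow along the edges of a graph, weighted by the increase of a potential `r`. -/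
theorem IsFlow.sum_mul_potential {G : SimpleGraph V} {s t : V} {f : V → V → ℝ}
    (hf : IsFlow G s t f) (hst : s ≠ t) (r : V → ℝ) :
    ∑ u, ∑ v, f u v * (r v - r u) = 2 * (r t - r s) * flowValue s f := by
  classical
  have hanti : ∑ u, ∑ v, f u v * r v = - ∑ u, ∑ v, f u v * r u := by
    rw [sum_comm, ← sum_neg_distrib]
    refine sum_congr rfl fun u _ => ?_
    rw [← sum_neg_distrib]
    refine sum_congr rfl fun v _ => ?_
    rw [hf.antisymm v u]
    ring
  have htot : ∑ u, ∑ v, f u v = 0 := by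
    have h : ∑ u, ∑ v, f u v = - ∑ u, ∑ v, f u v := by
      conv_lhs => rw [sum_comm]
      rw [← sum_neg_distrib]
      refine sum_congr rfl fun u _ => ?_
      rw [← sum_neg_distrib]
      exact sum_congr rfl fun v _ => hf.antisymm v u
    linarith
  -- Conservation kills every term except those at the two terminals.
  have hout : ∀ g : V → ℝ, ∑ u, g u * ∑ v, f u v =
      g s * ∑ v, f s v + g t * ∑ v, f t v := by
    intro g
    rw [← sum_pair (f := fun u => g u * ∑ v, f u v) hst]
    refine (sum_subset (subset_univ _) fun u _ hu => ?_).symm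
    simp only [mem_insert, mem_singleton, not_or] at hu
    rw [hf.conservation u hu.1 hu.2, mul_zero]
  have ht : ∑ v, f t v = - ∑ v, f s v := by
    have := hout fun _ => 1
    simp only [one_mul] at this
    linarith
  have hr : ∑ u, ∑ v, f u v * r u = (r s - r t) * flowValue s f := by
    have := hout r
    rw [ht] at this
    simp only [mul_sum] at this
    rw [flowValue]
    simp only [mul_comm (f _ _)]
    rw [this, ← mul_sum, mul_comm (r t), sub_mul, mul_comm (r t)]
    ring
  simp only [mul_sub, sum_sub_distrib]
  rw [hanti, hr]
  ring

/-- In the union of an edge-disjoint ranked path system every maximum flow saturates all edges. -/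
theorem IsMaxFlow.eq_one_of_rank_lt [Fintype P] {w : P → ℕ → V} {K : ℕ} {s t : V} {r : V → ℕ}
    (hw : IsPathSystem w K s t r) (hst : s ≠ t) {f : V → V → ℝ}
    (hf : IsMaxFlow (walkGraph w K) s t f) {u v : V} (h : (walkGraph w K).Adj u v)
    (huv : r u < r v) : f u v = 1 := by
  classical
  set D : Finset (V × V) := univ.filter fun e => (walkGraph w K).Adj e.1 e.2 ∧ r e.1 < r e.2
    with hD
  have hval : (Fintype.card P : ℝ) ≤ flowValue s f := by
    rw [← flowValue_walkFlow hw hst]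
    exact hf.2 _ (isFlow_walkFlow hw)
  have hcard : (#D : ℝ) ≤ K * Fintype.card P := by
    have hsub : D ⊆ (univ ×ˢ range K).image fun x : P × ℕ => (w x.1 x.2, w x.1 (x.2 + 1)) := by
      rintro ⟨a, b⟩ hab
      simp only [hD, mem_filter, mem_univ, true_and] at hab
      obtain ⟨hK, -, p, h1, h2⟩ := walkGraph_adj_of_rank_lt hw.rank hab.1 hab.2
      exact mem_image.2 ⟨(p, r a), by simp [hK], by simp [h1, h2]⟩
    have := (card_le_card hsub).trans card_image_le
    rw [card_product, card_univ, card_range, mul_comm] at this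
    exact_mod_cast this
  have hsum : ∑ e ∈ D, f e.1 e.2 = K * flowValue s f := by
    -- The rank changes by exactly one along an edge, so by antisymmetry both orientations
    -- contribute the upward flow. This factor 2 cancels the one in the potential identity.
    have hpot := hf.1.sum_mul_potential hst fun v => (r v : ℝ)
    have hsplit : ∀ a b, f a b * ((r b : ℝ) - r a) =
        (if (a, b) ∈ D then f a b else 0) + if (b, a) ∈ D then f b a else 0 := by
      intro a b
      by_cases hab : (walkGraph w K).Adj a b
      · rcases walkGraph_adj_rank hw.rank hab with hlt | hlt
        · have hb := (walkGraph_adj_of_rank_lt hw.rank hab hlt).2.1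
          rw [if_pos (by simp [hD, hab, hlt]), if_neg (by simp [hD, hlt.le]), hb]
          push_cast
          ring
        · have hb := (walkGraph_adj_of_rank_lt hw.rank hab.symm hlt).2.1
          rw [if_neg (by simp [hD, hlt.le]), if_pos (by simp [hD, hab.symm, hlt]), hb,
            hf.1.antisymm a b]
          push_cast
          ring
      · have hba : ¬ (walkGraph w K).Adj b a := fun h' => hab h'.symm
        simp [hD, hab, hba, hf.1.zero_of_not_adj a b hab]
    simp only [hsplit, sum_add_distrib] at hpot
    rw [sum_comm (f := fun a b => if (b, a) ∈ D then f b a else 0)] at hpot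
    have hDs : ∑ e ∈ D, f e.1 e.2 = ∑ a, ∑ b, if (a, b) ∈ D then f a b else 0 := by
      rw [← Fintype.sum_prod_type' fun a b => if (a, b) ∈ D then f a b else 0]
      simp
    rw [hw.rank_start, hw.rank_finish] at hpot
    rw [hDs]
    push_cast at hpot
    linarith
  have hle : ∀ e ∈ D, f e.1 e.2 ≤ 1 := fun e he =>
    hf.1.capacity _ _ (mem_filter.1 he).2.1
  -- Squeeze: `#D ≤ K * card P ≤ K * flowValue s f`, which is the sum over `D`; hence every term
  -- attains its bound 1.
  have heq : ∑ e ∈ D, f e.1 e.2 = ∑ e ∈ D, (1 : ℝ) := by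
    refine le_antisymm (sum_le_sum hle) ?_
    rw [hsum, sum_const, nsmul_eq_mul, mul_one]
    exact hcard.trans (mul_le_mul_of_nonneg_left hval (Nat.cast_nonneg _))
  exact (sum_eq_sum_iff_of_le hle).1 heq (u, v) (by simp [hD, h, huv])

/-- A set recovering a maximum flow in the union of an edge-disjoint ranked path system is the
whole edge set. -/
theorem RecoversMaxFlow.mem_iff [Fintype P] {w : P → ℕ → V} {K : ℕ} {s t : V} {r : V → ℕ}
    (hw : IsPathSystem w K s t r) (hst : s ≠ t) {F : Finset (Sym2 V)}
    (hF : RecoversMaxFlow (walkGraph w K) s t F) (u v : V) :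
    s(u, v) ∈ F ↔ (walkGraph w K).Adj u v := by
  obtain ⟨hsub, f, hf, hmem⟩ := hF
  refine ⟨fun h => hsub _ h, fun h => ?_⟩
  rcases walkGraph_adj_rank hw.rank h with hlt | hlt
  · exact hmem u v (by rw [hf.eq_one_of_rank_lt hw hst h hlt]; exact one_ne_zero)
  · rw [Sym2.eq_swap]
    exact hmem v u (by rw [hf.eq_one_of_rank_lt hw hst h.symm hlt]; exact one_ne_zero)

end PathSystem

/-! ### The hard graphs and their hidden bits -/

section HardFamily

/-- The vertices of the hard graphs: the two terminals `Sum.inl _`, and four groups of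
`Fin m × Fin m × Bool`: the first and the last inner vertices of the paths (groups `0` and `3`),
and the vertices `(l, i, b)` of the left and of the right layers number `l` (groups `1` and `2`). -/
abbrev HardVertex (m : ℕ) : Type := Bool ⊕ (Fin 4 × Fin m × Fin m × Bool)

/-- The position of a vertex on the paths through it. -/
def hardRank {m : ℕ} : HardVertex m → ℕ
  | .inl false => 0
  | .inl true => 2 * m + 3
  | .inr (0, _) => 1
  | .inr (1, l, _) => 2 * l + 2
  | .inr (2, l, _) => 2 * l + 3
  | .inr (3, _) => 2 * m + 2

/-- The path number `(i, j, b)` of the hard graph with the hidden bits `z`. In the layers number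
`l` it steps from the left vertex `(l, i, b)` to the right vertex `(l, j, b ^^ z (l, i, j))`. -/
def hardPath {m : ℕ} (z : Fin m × Fin m × Fin m → Bool) (p : Fin m × Fin m × Bool) (k : ℕ) :
    HardVertex m :=
  if k = 0 then .inl false
  else if k = 1 then .inr (0, p)
  else if h : 2 ≤ k ∧ k < 2 * m + 2 then
    if k % 2 = 0 then .inr (1, ⟨(k - 2) / 2, by omega⟩, p.1, p.2.2)
    else .inr (2, ⟨(k - 2) / 2, by omega⟩, p.2.1, p.2.2 ^^ z (⟨(k - 2) / 2, by omega⟩, p.1, p.2.1))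
  else if k = 2 * m + 2 then .inr (3, p)
  else .inl true

variable {m : ℕ} (z : Fin m × Fin m × Fin m → Bool) (p : Fin m × Fin m × Bool)

theorem hardPath_one : hardPath z p 1 = .inr (0, p) := rfl

theorem hardPath_left (l : Fin m) : hardPath z p (2 * l + 2) = .inr (1, l, p.1, p.2.2) := by
  have h := l.2
  have h' : 2 * (l : ℕ) + 2 < 2 * m + 2 := by omega
  simp [hardPath, h']

theorem hardPath_right (l : Fin m) :
    hardPath z p (2 * l + 3) = .inr (2, l, p.2.1, p.2.2 ^^ z (l, p.1, p.2.1)) := by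
  have h := l.2
  have h1 : 2 * (l : ℕ) + 3 < 2 * m + 2 := by omega
  have h2 : (2 * (l : ℕ) + 3) % 2 = 1 := by omega
  have h4 : (2 * (l : ℕ) + 1) / 2 = l := by omega
  simp [hardPath, h1, h2, h4]

theorem hardPath_last : hardPath z p (2 * m + 2) = .inr (3, p) := by
  simp [hardPath]

theorem hardPath_end : hardPath z p (2 * m + 3) = .inl true := by
  simp [hardPath]

theorem position_cases {k : ℕ} (hk : k ≤ 2 * m + 3) :
    k = 0 ∨ k = 1 ∨ (∃ l : Fin m, k = 2 * l + 2) ∨ (∃ l : Fin m, k = 2 * l + 3) ∨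
      k = 2 * m + 2 ∨ k = 2 * m + 3 := by
  by_cases h0 : k < 2
  · omega
  by_cases h1 : 2 * m + 2 ≤ k
  · omega
  obtain h | h := Nat.mod_two_eq_zero_or_one k
  · exact Or.inr (Or.inr (Or.inl ⟨⟨(k - 2) / 2, by omega⟩, by simp only; omega⟩))
  · exact Or.inr (Or.inr (Or.inr (Or.inl ⟨⟨(k - 2) / 2, by omega⟩, by simp only; omega⟩)))

theorem hardRank_hardPath {k : ℕ} (hk : k ≤ 2 * m + 3) : hardRank (hardPath z p k) = k := by
  obtain rfl | rfl | ⟨l, rfl⟩ | ⟨l, rfl⟩ | rfl | rfl := position_cases hk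
  · rfl
  · rfl
  · rw [hardPath_left]; rfl
  · rw [hardPath_right]; rfl
  · rw [hardPath_last]; rfl
  · rw [hardPath_end]; rfl

/-- A left vertex shows `i` and `b`, a right vertex shows `j`, so an edge between them identifies
the path whatever the hidden bits are. The private vertices of groups `0` and `3` keep the remaining
edges distinct. -/
theorem hardPath_disjoint {q : Fin m × Fin m × Bool} {k : ℕ} (hk : k < 2 * m + 3)
    (h1 : hardPath z p k = hardPath z q k)
    (h2 : hardPath z p (k + 1) = hardPath z q (k + 1)) : p = q := by
  obtain ⟨i, j, b⟩ := p
  obtain ⟨i', j', b'⟩ := q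
  obtain rfl | rfl | ⟨l, rfl⟩ | ⟨l, rfl⟩ | rfl | rfl := position_cases hk.le
  · simpa [hardPath_one] using h2
  · simpa [hardPath_one] using h1
  · simp only [hardPath_left, Sum.inr.injEq, Prod.mk.injEq, true_and] at h1
    simp only [hardPath_right, Sum.inr.injEq, Prod.mk.injEq, true_and] at h2
    simp [h1, h2.1]
  · by_cases hl : (l : ℕ) + 1 < m
    · obtain ⟨l', hl'⟩ : ∃ l' : Fin m, 2 * (l : ℕ) + 3 + 1 = 2 * l' + 2 :=
        ⟨⟨l + 1, hl⟩, by simp only; omega⟩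
      rw [hl'] at h2
      simp only [hardPath_right, Sum.inr.injEq, Prod.mk.injEq, true_and] at h1
      simp only [hardPath_left, Sum.inr.injEq, Prod.mk.injEq, true_and] at h2
      simp [h1.1, h2]
    · have hl' : 2 * (l : ℕ) + 3 + 1 = 2 * m + 2 := by omega
      rw [hl'] at h2
      simpa [hardPath_last] using h2
  · simpa [hardPath_last] using h1
  · omega

variable {V : Type*} {s t : V} {e : HardVertex m → V}

/-- The hard graph with the hidden bits `z`, embedded by `e`. -/
def hardGraph (e : HardVertex m → V) (z : Fin m × Fin m × Fin m → Bool) : SimpleGraph V :=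
  walkGraph (fun p k => e (hardPath z p k)) (2 * m + 3)

/-- Vertices outside the image of `e` are isolated in the hard graph, so their default rank 0 is
harmless. -/
theorem isPathSystem_hardPath (he : Function.Injective e) (hs : e (.inl false) = s)
    (ht : e (.inl true) = t) :
    IsPathSystem (fun p k => e (hardPath z p k)) (2 * m + 3) s t
      (Function.extend e hardRank 0) where
  rank p k hk := by rw [he.extend_apply, hardRank_hardPath z p hk]
  start p := hs
  finish p := by rw [hardPath_end, ht]
  rank_start := by rw [← hs, he.extend_apply]; rfl
  rank_finish := by rw [← ht, he.extend_apply]; rfl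
  disjoint p q k hk h1 h2 := hardPath_disjoint z p hk (he h1) (he h2)

/-- The bit at `(l, i, j)` is read off the right end of the edge that path `(i, j, false)` uses in
layer pair `l`. -/
theorem hardGraph_injective (he : Function.Injective e) :
    Function.Injective (hardGraph e) := by
  intro z z' h
  funext ⟨l, i, j⟩
  have hw := isPathSystem_hardPath z he rfl rfl
  have hw' := isPathSystem_hardPath z' he rfl rfl
  have hk : 2 * (l : ℕ) + 2 < 2 * m + 3 := by omega
  have hadj : (hardGraph e z).Adj _ _ := walkGraph_adj_step hw.rank (i, j, false) hk
  rw [h] at hadj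
  have hrank : ∀ k ≤ 2 * m + 3,
      Function.extend e hardRank 0 (e (hardPath z (i, j, false) k)) = k := hw.rank (i, j, false)
  have h1 := hrank _ hk.le
  have h2 := hrank _ hk
  obtain ⟨-, -, q, hq1, hq2⟩ := walkGraph_adj_of_rank_lt hw'.rank hadj (by rw [h1, h2]; omega)
  rw [h1] at hq1 hq2
  have hq1 := he hq1
  have hq2 := he hq2
  obtain ⟨i', j', b'⟩ := q
  simp only [hardPath_left, Sum.inr.injEq, Prod.mk.injEq, true_and] at hq1
  simp only [hardPath_right, Sum.inr.injEq, Prod.mk.injEq, true_and] at hq2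
  obtain ⟨rfl, rfl⟩ := hq1
  obtain ⟨rfl, hq2⟩ := hq2
  simpa using hq2.symm

variable [Fintype V]

/-- A set of edges recovers a maximum flow in at most one of the hard graphs. -/
theorem eq_of_recoversMaxFlow_hardGraph (he : Function.Injective e) (hs : e (.inl false) = s)
    (ht : e (.inl true) = t) {z z' : Fin m × Fin m × Fin m → Bool} {F : Finset (Sym2 V)}
    (h : RecoversMaxFlow (hardGraph e z) s t F) (h' : RecoversMaxFlow (hardGraph e z') s t F) :
    z = z' := by
  have hst : s ≠ t := by
    rw [← hs, ← ht]
    exact fun h => by simpa using he h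
  refine hardGraph_injective he (SimpleGraph.ext ?_)
  funext u v
  exact propext ((h.mem_iff (isPathSystem_hardPath z he hs ht) hst u v).symm.trans
    (h'.mem_iff (isPathSystem_hardPath z' he hs ht) hst u v))

theorem exists_hardVertex_embedding {n : ℕ} (hn : 8 * m ^ 2 + 2 ≤ n) {s t : Fin n} (hst : s ≠ t) :
    ∃ e : HardVertex m → Fin n,
      Function.Injective e ∧ e (.inl false) = s ∧ e (.inl true) = t := by
  have hcard : Fintype.card (Fin 4 × Fin m × Fin m × Bool) ≤
      Fintype.card {v : Fin n // v ∉ ({s, t} : Finset (Fin n))} := by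
    rw [Fintype.card_subtype_compl, Fintype.card_coe, card_pair hst]
    simp only [Fintype.card_prod, Fintype.card_fin, Fintype.card_bool]
    have : 4 * (m * (m * 2)) = 8 * m ^ 2 := by ring
    omega
  obtain ⟨g⟩ := Function.Embedding.nonempty_of_card_le hcard
  have hg : ∀ x, (g x : Fin n) ≠ s ∧ (g x : Fin n) ≠ t := fun x => by simpa using (g x).2
  refine ⟨Sum.elim (fun b => if b then t else s) fun x => g x, ?_, rfl, rfl⟩
  refine Function.Injective.sumElim ?_ (Subtype.val_injective.comp g.injective) ?_
  · rintro (_ | _) (_ | _) h <;> simp_all [eq_comm]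
  · rintro (_ | _) x h
    · exact (hg x).1 h.symm
    · exact (hg x).2 h.symm

end HardFamily

/-! ### Counting outputs and averaging over coins -/

section Counting

variable {V : Type*} [Fintype V] {α : Type*}

theorem cutValue_lt (G : SimpleGraph V) (S : Finset V) :
    cutValue G S < Fintype.card V ^ 2 + 1 := by
  classical
  unfold cutValue
  refine Nat.lt_succ_of_le ((card_le_univ _).trans ?_)
  rw [Fintype.card_prod, sq]

/-- Within `Q` queries a decision tree reaches at most `(|V| ^ 2 + 1) ^ Q` outputs. -/
theorem DecisionTree.exists_outputs (T : DecisionTree V α) (Q : ℕ) :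
    ∃ O : Finset α, #O ≤ (Fintype.card V ^ 2 + 1) ^ Q ∧
      ∀ G : SimpleGraph V, T.queryCount G ≤ Q → T.run G ∈ O := by
  classical
  induction T generalizing Q with
  | output a =>
    exact ⟨{a}, by rw [card_singleton]; exact Nat.one_le_pow _ _ (Nat.succ_pos _),
      fun G _ => mem_singleton_self a⟩
  | query S next ih =>
    cases Q with
    | zero => exact ⟨∅, by simp, fun G h => by simp [queryCount] at h⟩
    | succ Q =>
      choose O hO hmem using fun a => ih a Q
      -- Only answers below `|V| ^ 2 + 1` occur, so finitely many subtrees matter.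
      refine ⟨(range (Fintype.card V ^ 2 + 1)).biUnion O, ?_, fun G h => ?_⟩
      · refine (card_biUnion_le_card_mul _ _ _ fun a _ => hO a).trans ?_
        rw [card_range, pow_succ' (Fintype.card V ^ 2 + 1)]
      · exact mem_biUnion.2 ⟨_, mem_range.2 (cutValue_lt G S), hmem _ G (Nat.le_of_succ_le_succ h)⟩

theorem DecisionTree.card_success_le {Z : Type*} [Fintype Z] (T : DecisionTree V α) (Q : ℕ)
    (g : Z → SimpleGraph V) (good : Z → α → Prop)
    (hgood : ∀ a z z', good z a → good z' a → z = z') (I : Finset Z)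
    (hI : ∀ z ∈ I, good z (T.run (g z)) ∧ T.queryCount (g z) ≤ Q) :
    #I ≤ (Fintype.card V ^ 2 + 1) ^ Q := by
  obtain ⟨O, hO, hmem⟩ := T.exists_outputs Q
  refine (card_le_card_of_injOn (fun z => T.run (g z)) (fun z hz => hmem _ (hI z hz).2) ?_).trans hO
  intro z hz z' hz' h
  refine hgood _ z z' (hI z hz).1 ?_
  have h : T.run (g z) = T.run (g z') := h
  rw [h]
  exact (hI z' hz').1

open MeasureTheory

/-- If every output is good for at most one member of a family of graphs, a randomized algorithm
with few queries cannot succeed on a large family. -/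
theorem RandomizedAlgorithm.card_mul_le {Z : Type*} [Fintype Z] [Countable α]
    (A : RandomizedAlgorithm V α) (g : Z → SimpleGraph V) (good : Z → α → Prop)
    (hgood : ∀ a z z', good z a → good z' a → z = z') (Q : ℕ) (δ : ℝ≥0∞)
    (hsucc : ∀ z, 2 * δ ≤ A.successProb (g z) (good z))
    (hδ : δ ≠ ⊤)
    (hquery : ∀ z, A.expectedQueries (g z) ≤ δ * (Q + 1 : ℕ)) :
    (Fintype.card Z : ℝ≥0∞) * δ ≤ ((Fintype.card V ^ 2 + 1) ^ Q : ℕ) := by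
  classical
  let _ := A.measurableSpace
  have := A.isProbabilityMeasure
  set S : Z → Set A.Ω := fun z => {ω | good z ((A.tree ω).run (g z))}
  set B : Z → Set A.Ω := fun z => {ω | (A.tree ω).queryCount (g z) ≤ Q}
  have hcount : ∀ z, Measurable fun ω => (A.tree ω).queryCount (g z) := fun z =>
    measurable_to_countable' fun k => A.measurableSet_queryCount (g z) k
  have hS : ∀ z, MeasurableSet (S z) := by
    intro z
    have : S z = ⋃ a ∈ {a | good z a}, {ω | (A.tree ω).run (g z) = a} := by
      ext ω
      simp [S]
    rw [this]
    exact MeasurableSet.biUnion (Set.to_countable _) fun a _ => A.measurableSet_run (g z) a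
  have hB : ∀ z, MeasurableSet (B z) := fun z => hcount z measurableSet_Iic
  -- Markov's inequality at threshold `Q + 1`, the complement of at most `Q` queries.
  have hBc : ∀ z, A.μ (B z)ᶜ ≤ δ := by
    intro z
    have hmark := mul_meas_ge_le_lintegral₀ (μ := A.μ)
      (f := fun ω => ((A.tree ω).queryCount (g z) : ℝ≥0∞))
      (measurable_from_top.comp (hcount z)).aemeasurable ((Q + 1 : ℕ) : ℝ≥0∞)
    have hset : {ω | ((Q + 1 : ℕ) : ℝ≥0∞) ≤ ((A.tree ω).queryCount (g z) : ℝ≥0∞)} = (B z)ᶜ := by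
      ext ω
      simp only [B, Set.mem_ofPred_eq, Set.mem_compl_iff, Nat.cast_le]
      omega
    rw [hset] at hmark
    have h := hmark.trans (hquery z)
    rw [mul_comm δ] at h
    exact (ENNReal.mul_le_mul_iff_right (by simp) (ENNReal.natCast_ne_top _)).1 h
  have hSB : ∀ z, δ ≤ A.μ (S z ∩ B z) := by
    intro z
    have h1 : A.μ (S z) ≤ A.μ (S z ∩ B z) + δ := by
      refine (measure_le_inter_add_sdiff _ _ (B z)).trans ?_
      gcongr
      exact (measure_mono fun ω h => h.2).trans (hBc z)
    have h2 : δ + δ ≤ A.μ (S z ∩ B z) + δ := by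
      rw [← two_mul]
      exact (hsucc z).trans h1
    exact (ENNReal.add_le_add_iff_right hδ).1 h2
  -- Double counting: sum over instances the probability of success within `Q` queries, then
  -- exchange sum and integral to bound the count for each fixed coin.
  calc (Fintype.card Z : ℝ≥0∞) * δ = ∑ _z : Z, δ := by simp
    _ ≤ ∑ z, A.μ (S z ∩ B z) := sum_le_sum fun z _ => hSB z
    _ = ∑ z, ∫⁻ ω, (S z ∩ B z).indicator 1 ω ∂A.μ :=
        sum_congr rfl fun z _ => (lintegral_indicator_one ((hS z).inter (hB z))).symm
    _ = ∫⁻ ω, ∑ z, (S z ∩ B z).indicator 1 ω ∂A.μ :=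
        (lintegral_finsetSum _ fun z _ =>
          measurable_one.indicator ((hS z).inter (hB z))).symm
    _ ≤ ∫⁻ _ω, (((Fintype.card V ^ 2 + 1) ^ Q : ℕ) : ℝ≥0∞) ∂A.μ := by
        refine lintegral_mono fun ω => ?_
        have hω : ∑ z, (S z ∩ B z).indicator (1 : A.Ω → ℝ≥0∞) ω =
            #(univ.filter fun z => ω ∈ S z ∩ B z) := by
          rw [card_filter, Nat.cast_sum]
          refine sum_congr rfl fun z _ => ?_
          by_cases h : ω ∈ S z ∩ B z
          · rw [Set.indicator_of_mem h, if_pos h, Pi.one_apply, Nat.cast_one]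
          · rw [Set.indicator_of_notMem h, if_neg h, Nat.cast_zero]
        rw [hω]
        refine Nat.cast_le.2 ?_
        exact (A.tree ω).card_success_le Q g good hgood _ fun z hz => (mem_filter.1 hz).2
    _ = ((Fintype.card V ^ 2 + 1) ^ Q : ℕ) := by simp

end Counting

/-! ### Numerical estimates -/

section Asymptotics

/-- The side length of the hard graphs with `n` vertices. -/
theorem exists_side_length {n : ℕ} (hn : 400 ≤ n) :
    ∃ m : ℕ, 8 * m ^ 2 + 2 ≤ n ∧ (n : ℝ) ^ (3 / 2 : ℝ) / 64 ≤ (m : ℝ) ^ 3 := by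
  have hn' : (400 : ℝ) ≤ n := by exact_mod_cast hn
  set x := Real.sqrt n with hx
  have hx2 : x ^ 2 = n := Real.sq_sqrt (by positivity)
  have hx20 : 20 ≤ x := Real.le_sqrt_of_sq_le (by norm_num [hn])
  refine ⟨⌈x / 4⌉₊, ?_, ?_⟩
  · have h := (Nat.ceil_lt_add_one (by positivity : 0 ≤ x / 4)).le
    have h' : (8 : ℝ) * (⌈x / 4⌉₊ : ℝ) ^ 2 + 2 ≤ n := by
      have : (⌈x / 4⌉₊ : ℝ) ^ 2 ≤ (x / 4 + 1) ^ 2 := pow_le_pow_left₀ (Nat.cast_nonneg _) h 2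
      nlinarith
    exact_mod_cast h'
  · have h : (x / 4) ^ 3 ≤ (⌈x / 4⌉₊ : ℝ) ^ 3 :=
      pow_le_pow_left₀ (by positivity) (Nat.le_ceil _) 3
    have hpow : (n : ℝ) ^ (3 / 2 : ℝ) = x ^ 3 := by
      rw [hx, Real.sqrt_eq_rpow, ← Real.rpow_natCast, ← Real.rpow_mul (by positivity)]
      norm_num
    rw [hpow]
    linarith [h, (by ring : (x / 4) ^ 3 = x ^ 3 / 64)]

/-- `2 ^ (m ^ 3)` exceeds `exp (y / 100)`; one factor `exp (y / 200)` covers the count of outputs,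
the other beats `2 / p`. -/
theorem pow_lt_of_queries_le {p : ℝ} (hp : 0 < p) {n m Q : ℕ} (hn : 400 ≤ n)
    (hnp : 400 / p < n) (hm : (n : ℝ) ^ (3 / 2 : ℝ) / 64 ≤ (m : ℝ) ^ 3)
    (hQ : (Q : ℝ) ≤ (n : ℝ) ^ (3 / 2 : ℝ) / Real.log n / 600) :
    (((n ^ 2 + 1) ^ Q : ℕ) : ℝ) < 2 ^ (m ^ 3) * (p / 2) := by
  have hn' : (400 : ℝ) ≤ n := by exact_mod_cast hn
  have hn0 : (0 : ℝ) < n := by linarith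
  set y := (n : ℝ) ^ (3 / 2 : ℝ) with hy
  have hny : (n : ℝ) ≤ y := by
    simpa using Real.rpow_le_rpow_of_exponent_le (by linarith : (1 : ℝ) ≤ n)
      (by norm_num : (1 : ℝ) ≤ 3 / 2)
  have hlog : 0 < Real.log n := Real.log_pos (by linarith)
  have h1 : (((n ^ 2 + 1) ^ Q : ℕ) : ℝ) ≤ Real.exp (y / 200) := by
    have hbase : (n : ℝ) ^ 2 + 1 ≤ Real.exp (3 * Real.log n) := by
      have : Real.exp (3 * Real.log n) = (n : ℝ) ^ 3 := by
        rw [← Real.exp_log (pow_pos hn0 3), Real.log_pow]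
        norm_num
      rw [this]
      nlinarith [sq_nonneg (n : ℝ)]
    push_cast
    calc ((n : ℝ) ^ 2 + 1) ^ Q ≤ Real.exp (3 * Real.log n) ^ Q :=
          pow_le_pow_left₀ (by positivity) hbase Q
      _ = Real.exp (Q * (3 * Real.log n)) := (Real.exp_nat_mul _ _).symm
      _ ≤ Real.exp (y / 200) := by
          refine Real.exp_le_exp.2 ?_
          calc (Q : ℝ) * (3 * Real.log n) ≤ y / Real.log n / 600 * (3 * Real.log n) := by gcongr
            _ = y / 200 := by field_simp; ring
  -- This uses `log 2 / 64 > 1 / 100`.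
  have h2 : Real.exp (y / 100) ≤ 2 ^ (m ^ 3) := by
    rw [← Real.exp_log (by positivity : (0 : ℝ) < 2 ^ (m ^ 3)), Real.log_pow]
    refine Real.exp_le_exp.2 ?_
    push_cast
    have := Real.log_two_gt_d9
    nlinarith
  have h3 : 1 < Real.exp (y / 200) * (p / 2) := by
    have h := Real.add_one_le_exp (y / 200)
    have hnp' : 400 < n * p := (div_lt_iff₀ hp).1 hnp
    nlinarith
  calc (((n ^ 2 + 1) ^ Q : ℕ) : ℝ) ≤ Real.exp (y / 200) := h1
    _ < Real.exp (y / 200) * (Real.exp (y / 200) * (p / 2)) :=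
        lt_mul_of_one_lt_right (Real.exp_pos _) h3
    _ = Real.exp (y / 100) * (p / 2) := by
        rw [← mul_assoc, ← Real.exp_add]
        ring_nf
    _ ≤ 2 ^ (m ^ 3) * (p / 2) := by gcongr

end Asymptotics

end CutQuery

open CutQuery in
theorem mainTheorem8 (p : ℝ) (hp : 0 < p) (hp1 : p ≤ 1) :
    ∃ c : ℝ, 0 < c ∧ ∃ N : ℕ, ∀ n : ℕ, N ≤ n → ∀ s t : Fin n, s ≠ t →
      ∀ A : CutQuery.RandomizedAlgorithm (Fin n) (Finset (Sym2 (Fin n))),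
        (∀ G : SimpleGraph (Fin n),
          ENNReal.ofReal p ≤ A.successProb G (CutQuery.RecoversMaxFlow G s t)) →
        ∃ G : SimpleGraph (Fin n),
          ENNReal.ofReal (c * ((n : ℝ) ^ (3 / 2 : ℝ) / Real.log n)) ≤ A.expectedQueries G := by
  -- The constant is `δ / 600` with `δ = p / 2`, so `c * X ≤ δ * (Q + 1)` for `Q = ⌊X / 600⌋₊`.
  refine ⟨p / 1200, by positivity, max 400 (⌊400 / p⌋₊ + 1), fun n hn s t hst A hA => ?_⟩
  have hn400 : 400 ≤ n := (le_max_left _ _).trans hn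
  have hnp : 400 / p < n :=
    (Nat.lt_floor_add_one _).trans_le (by exact_mod_cast (le_max_right _ _).trans hn)
  by_contra! hlt
  obtain ⟨m, hmn, hm⟩ := exists_side_length hn400
  obtain ⟨e, he, hes, het⟩ := exists_hardVertex_embedding hmn hst
  set X := (n : ℝ) ^ (3 / 2 : ℝ) / Real.log n with hX
  have hX0 : 0 ≤ X := div_nonneg (by positivity) (Real.log_natCast_nonneg n)
  set Q := ⌊X / 600⌋₊ with hQ
  have hQX : (Q : ℝ) ≤ X / 600 := Nat.floor_le (by positivity)
  have key := A.card_mul_le (hardGraph e) (fun z => RecoversMaxFlow (hardGraph e z) s t)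
    (fun F z z' h h' => eq_of_recoversMaxFlow_hardGraph he hes het h h') Q
    (ENNReal.ofReal (p / 2)) (fun z => ?_) ENNReal.ofReal_ne_top fun z => ?_
  · rw [← ENNReal.ofReal_natCast, ← ENNReal.ofReal_natCast,
      ← ENNReal.ofReal_mul (Nat.cast_nonneg _),
      ENNReal.ofReal_le_ofReal_iff (Nat.cast_nonneg _)] at key
    refine absurd key (not_le.2 ?_)
    have hcard : Fintype.card (Fin m × Fin m × Fin m → Bool) = 2 ^ m ^ 3 := by
      simp only [Fintype.card_fun, Fintype.card_prod, Fintype.card_fin, Fintype.card_bool]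
      ring_nf
    rw [hcard, Fintype.card_fin, Nat.cast_pow 2, Nat.cast_ofNat]
    exact pow_lt_of_queries_le hp hn400 hnp hm hQX
  · rw [← ENNReal.ofReal_ofNat, ← ENNReal.ofReal_mul (by norm_num), mul_div_cancel₀ _ two_ne_zero]
    exact hA _
  · refine (hlt _).le.trans ?_
    rw [← ENNReal.ofReal_natCast, ← ENNReal.ofReal_mul (by positivity)]
    refine ENNReal.ofReal_le_ofReal ?_
    have h := (Nat.lt_floor_add_one (X / 600)).le
    push_cast
    nlinarith
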